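/- All groups are finite. Let $\mathrm{Irr}(G)$ be the set of complex irreducible characters of a group $G$, and for $\chi\in\mathrm{Irr}(G)$ let $Z(\chi)=\{g\in G : |\chi(g)|=\chi(1)\}$ be its center, which is a normal subgroup of $G$. The group $G$ is *nested* if for all $\chi,\psi\in\mathrm{Irr}(G)$ either $Z(\chi)\le Z(\psi)$ or $Z(\psi)\le Z(\chi)$; in this case the distinct centers of the irreducible characters form a chain $G=X_0>X_1>\dots>X_n\ge 1$, called the *chain of centers* of $G$. The group $G$ is *nested by degrees* if for all $\chi,\psi\in\mathrm{Irr}(G)$ with $\psi(1)\le\chi(1)$ one has $Z(\chi)\le Z(\psi)$. For a prime $p$, a $p$-group $G$ of order $p^m$ with $m\ge 2$ has *coclass* $r$ if its nilpotence class is $m-r$. **Lemma.** Let $p$ be a prime and let $G$ be a $p$-group of coclass $2$ and nilpotence class $c\ge 3$, and let $1=Z_0<Z_1<\dots<Z_c=G$ be the upper central series of $G$. Then $G$ is a nested group whose chain of centers is the upper central series of $G$ from $Z_1=Z(G)$ on, that is, the chain of centers is $G=Z_c>Z_{c-1}>\dots>Z_1$ (so $n=c-1$ and $X_i=Z_{c-i}$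 for $0\le i\le n$). If in addition $c\ge 4$, then $G$ is not nested by degrees. -/

import Mathlib

/-- `Irr(G)`: the set of complex irreducible characters of `G`, as functions on `G`. Every
finite-dimensional complex representation is isomorphic to one on some `ℂ^d`. -/
def irrChars (G : Type*) [Group G] : Set (G → ℂ) :=
  {χ | ∃ (d : ℕ) (ρ : Representation ℂ G (Fin d → ℂ)), ρ.IsIrreducible ∧ ρ.character = χ}

/-- The degree `χ(1)` of a character, as a real number. -/
def charDegree {G : Type*} [Group G] (χ : G → ℂ) : ℝ :=
  (χ 1).re

/-- The center `Z(χ) = {g ∈ G : |χ(g)| = χ(1)}` of a character. -/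
def charCenter {G : Type*} [Group G] (χ : G → ℂ) : Set G :=
  {g | ‖χ g‖ = charDegree χ}

/-- `G` is nested if the centers of its irreducible characters form a chain. -/
def IsNested (G : Type*) [Group G] : Prop :=
  ∀ χ ∈ irrChars G, ∀ ψ ∈ irrChars G,
    charCenter χ ⊆ charCenter ψ ∨ charCenter ψ ⊆ charCenter χ

/-- `G` is nested by degrees if `ψ(1) ≤ χ(1)` implies `Z(χ) ≤ Z(ψ)`, for all irreducible
characters `χ`, `ψ`. -/
def IsNestedByDegrees (G : Type*) [Group G] : Prop :=
  ∀ χ ∈ irrChars G, ∀ ψ ∈ irrChars G,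
    charDegree ψ ≤ charDegree χ → charCenter χ ⊆ charCenter ψ

/-- `G = X 0 > X 1 > ⋯ > X n` is the chain of centers of `G`: a strictly decreasing chain of normal
subgroups whose members are exactly the centers of the irreducible characters of `G`.
Only the values `X i` with `i ≤ n` matter. -/
def IsChainOfCenters {G : Type*} [Group G] (n : ℕ) (X : ℕ → Subgroup G) : Prop :=
  X 0 = ⊤ ∧
  (∀ i, i < n → X (i + 1) < X i) ∧
  (∀ i, i ≤ n → (X i).Normal) ∧
  (∀ χ ∈ irrChars G, ∃ i, i ≤ n ∧ charCenter χ = (X i : Set G)) ∧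
  (∀ i, i ≤ n → ∃ χ ∈ irrChars G, charCenter χ = (X i : Set G))

/-- The `p`-group `G` has coclass `r`: its order is `p ^ m` for some `m ≥ 2`, and its nilpotency
class is `m - r`. -/
def HasCoclass (p : ℕ) (G : Type*) [Group G] (r : ℕ) : Prop :=
  ∃ m : ℕ, 2 ≤ m ∧ Nat.card G = p ^ m ∧ Group.nilpotencyClass G + r = m

/-! Write `M(N)` for the preimage of the center of `G ⧸ N`. By Schur's lemma and equality in the
triangle inequality, `Z(χ) = M(ker χ)`, so the chain of centers is a question about normal
subgroups.

With `|G| = p^(c+2)`, the `c` upper central factors have two spare powers of `p` to share. The top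
factor is not cyclic, so it takes one. It cannot take both: the commutator would then be a
nondegenerate alternating form on a space of dimension 3 over the field with `p` elements. So
exactly one other factor has order `p^2`, and `exists_upperCentralSeriesStep_eq` deduces that every
`M(N)` is some `Z_i` with `i ≥ 1`. Conversely, irreducible characters separate the elements of `G ⧸
Z_k`, so each such `Z_i` occurs.

If `G` were nested by degrees, degrees would increase strictly as centers shrink. They are powers of
`p`, so a character with center `Z_{c-3}` would have degree at least `p^3`, against `χ(1)^2 ≤ |G :
Z(χ)| ≤ p^5`. -/

namespace Subgroup

/-! ### Upper central series and coclass two. -/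

open scoped commutatorElement

/-- Commuting an element of `M` with any `x` stays in `M` and drops one level of the series, so the
descent stops at a last element outside `Z_j`. -/
theorem exists_mem_upperCentralSeries_succ_notMem {G : Type*} [Group G] [Group.IsNilpotent G]
    {M : Subgroup G} [M.Normal] {j : ℕ} (h : ¬ M ≤ upperCentralSeries G j) :
    ∃ g ∈ M, g ∈ upperCentralSeries G (j + 1) ∧ g ∉ upperCentralSeries G j := by
  have key : ∀ i : ℕ, ∀ g ∈ M, g ∈ upperCentralSeries G i → g ∉ upperCentralSeries G j →
      ∃ g ∈ M, g ∈ upperCentralSeries G (j + 1) ∧ g ∉ upperCentralSeries G j := by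
    intro i
    induction i with
    | zero =>
      intro g _ hg hgj
      rw [upperCentralSeries_zero, mem_bot] at hg
      exact absurd (hg ▸ one_mem _) hgj
    | succ i ih =>
      intro g hgM hg hgj
      by_cases hx : ∀ x, ⁅g, x⁆ ∈ upperCentralSeries G j
      · exact ⟨g, hgM, hx, hgj⟩
      · push Not at hx
        obtain ⟨x, hx⟩ := hx
        refine ih _ ?_ (hg x) hx
        rw [commutatorElement_def, mul_assoc, mul_assoc, ← mul_assoc x]
        exact mul_mem hgM (Normal.conj_mem inferInstance _ (inv_mem hgM) x)
  obtain ⟨g, hgM, hg⟩ := SetLike.not_le_iff_exists.mp h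
  exact key (Group.nilpotencyClass G) g hgM (by simp) hg

theorem upperCentralSeries_lt_succ {G : Type*} [Group G] [Group.IsNilpotent G] {i : ℕ}
    (hi : i < Group.nilpotencyClass G) :
    upperCentralSeries G i < upperCentralSeries G (i + 1) := by
  refine lt_of_le_not_ge (upperCentralSeries_mono G i.le_succ) fun h => ?_
  obtain ⟨g, -, hg, hg'⟩ :=
    exists_mem_upperCentralSeries_succ_notMem (M := (⊤ : Subgroup G)) (j := i) fun h' =>
      hi.not_ge (upperCentralSeries_eq_top_iff_nilpotencyClass_le.mp (top_le_iff.mp h'))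
  exact hg' (h hg)

/-- If the quotient by the preimage of the center of `G ⧸ N` has prime or trivial order, then
`G ⧸ N` is abelian. -/
theorem upperCentralSeriesStep_eq_top_of_index_dvd_prime {G : Type*} [Group G] (N : Subgroup G)
    [N.Normal] {p : ℕ} (hp : p.Prime) (h : (upperCentralSeriesStep N).index ∣ p) :
    upperCentralSeriesStep N = ⊤ := by
  have hidx : Nat.card ((G ⧸ N) ⧸ center (G ⧸ N)) ∣ p := by
    rwa [upperCentralSeriesStep_eq_comap_center,
      index_comap_of_surjective _ (QuotientGroup.mk'_surjective N)] at h
  have hcyc : IsCyclic ((G ⧸ N) ⧸ center (G ⧸ N)) := by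
    rcases (Nat.dvd_prime hp).mp hidx with h1 | h1
    · have := (Nat.card_eq_one_iff_unique.mp h1).1
      infer_instance
    · have := Fact.mk hp
      exact isCyclic_of_prime_card h1
  have hcomm := (MonoidHom.isMulCommutative_of_isCyclic_of_ker_le_center
    (QuotientGroup.mk' (center (G ⧸ N))) (by rw [QuotientGroup.ker_mk'])).is_comm.comm
  rw [upperCentralSeriesStep_eq_comap_center, eq_top_iff]
  intro g _
  rw [mem_comap, mem_center_iff]
  exact fun x => hcomm _ _

/-- In a group of class at most two whose center has prime order, the centralizer of an element
has index dividing that prime. -/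
theorem index_centralizer_dvd_card_center {H : Type*} [Group H]
    (h2 : ∀ x y : H, ⁅x, y⁆ ∈ center H) (h : H) :
    (centralizer {h}).index ∣ Nat.card (center H) := by
  -- Multiplicative because commutators are central; its kernel is the centralizer of `h`.
  let φ : H →* center H :=
    { toFun := fun x => ⟨⁅h, x⁆, h2 h x⟩
      map_one' := by ext; simp
      map_mul' := fun x y => by
        ext
        have := mem_center_iff.mp (h2 h y) x
        simp only [coe_mul, commutatorElement_def] at this ⊢
        calc h * (x * y) * h⁻¹ * (x * y)⁻¹
            = h * x * h⁻¹ * (h * y * h⁻¹ * y⁻¹) * x⁻¹ := by group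
          _ = h * x * h⁻¹ * (x⁻¹ * (x * (h * y * h⁻¹ * y⁻¹))) * x⁻¹ := by group
          _ = h * x * h⁻¹ * x⁻¹ * (h * y * h⁻¹ * y⁻¹) := by rw [this]; group }
  have hker : φ.ker = centralizer {h} := by
    ext x
    rw [MonoidHom.mem_ker, mem_centralizer_singleton_iff, Subtype.ext_iff]
    exact commutatorElement_eq_one_iff_mul_comm.trans eq_comm
  rw [← hker, index_ker]
  exact card_subgroup_dvd_card _

/-- There is no group of order `p ^ 4` and class two whose center has order `p`. -/
theorem center_card_ne_prime_of_card_eq_prime_pow_four {H : Type*} [Group H] {p : ℕ}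
    (hp : p.Prime) (hcard : Nat.card H = p ^ 4) (h2 : ∀ x y : H, ⁅x, y⁆ ∈ center H) :
    Nat.card (center H) ≠ p := by
  intro hZ
  have hfin : Finite H := Nat.finite_of_card_ne_zero (by simp [hcard, hp.ne_zero])
  have hlt : ∀ {k : ℕ} {A B : Subgroup H}, A < B → Nat.card B ∣ p ^ (k + 1) →
      Nat.card A ∣ p ^ k := by
    intro k A B hAB hB
    obtain ⟨b, hb, hb'⟩ := (Nat.dvd_prime_pow hp).mp hB
    obtain ⟨a, ha, ha'⟩ := (Nat.dvd_prime_pow hp).mp ((card_dvd_of_le hAB.le).trans hB)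
    have : a < b := by
      by_contra hle
      refine hAB.ne (eq_of_le_of_card_ge hAB.le ?_)
      rw [ha', hb']
      exact Nat.pow_le_pow_right hp.pos (not_lt.mp hle)
    rw [ha']
    exact pow_dvd_pow _ (by omega)
  have hcent : ∀ h : H, center H ≤ centralizer {h} := fun h => center_le_centralizer _
  have hnt : ∀ {h : H}, h ∉ center H → ∃ z, z ∉ centralizer {h} := by
    intro h hh
    by_contra! hc
    exact hh (mem_center_iff.mpr fun x => mem_centralizer_singleton_iff.mp (hc x))
  obtain ⟨h₁, hh₁⟩ : ∃ h, h ∉ center H := by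
    by_contra! hc
    have : Nat.card (center H) = Nat.card H := by rw [(eq_top_iff' _).mpr hc, card_top]
    rw [hZ, hcard] at this
    exact absurd (Nat.pow_right_injective hp.two_le (a₁ := 1) (by simpa using this)) (by decide)
  obtain ⟨h₂, hh₂⟩ := hnt hh₁
  -- Each centralizer has index at most `p`, so the intersection has order at least `p^2` and
  -- exceeds the center.
  obtain ⟨w, hw, hwZ⟩ : ∃ w ∈ centralizer {h₁} ⊓ centralizer {h₂}, w ∉ center H := by
    by_contra! hc
    have h1 := card_le_of_le (show centralizer {h₁} ⊓ centralizer {h₂} ≤ center H from hc)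
    have h3 : (centralizer {h₁} ⊓ centralizer {h₂}).index ≤ p * p :=
      index_inf_le.trans (Nat.mul_le_mul
        (Nat.le_of_dvd hp.pos (hZ ▸ index_centralizer_dvd_card_center h2 h₁))
        (Nat.le_of_dvd hp.pos (hZ ▸ index_centralizer_dvd_card_center h2 h₂)))
    have h4 := card_mul_index (centralizer {h₁} ⊓ centralizer {h₂})
    rw [hcard] at h4
    have h5 : p ^ 4 ≤ p * (p * p) := h4 ▸ Nat.mul_le_mul (hZ ▸ h1) h3
    have h6 : p ^ 3 < p ^ 4 := Nat.pow_lt_pow_right hp.one_lt (by decide)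
    nlinarith
  obtain ⟨z, hz⟩ := hnt hwZ
  have hw1 := (mem_inf.mp hw).1
  have hw2 := (mem_inf.mp hw).2
  have comm : ∀ {a b : H}, a ∈ centralizer {b} → b ∈ centralizer {a} := fun h =>
    mem_centralizer_singleton_iff.mpr (mem_centralizer_singleton_iff.mp h).symm
  have self : ∀ a : H, a ∈ centralizer {a} := fun a => mem_centralizer_singleton_iff.mpr rfl
  -- Four strict inclusions from `H` down to its center, witnessed by `z`, `h₂`, `h₁`, `w`, leave
  -- the center only order 1.
  have s1 : centralizer {w} < ⊤ := lt_top_iff_ne_top.mpr fun h => hz (h ▸ mem_top z)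
  have s2 : centralizer {w} ⊓ centralizer {h₁} < centralizer {w} :=
    lt_of_le_of_ne inf_le_left fun h => hh₂ (inf_eq_left.mp h (comm hw2))
  have s3 : centralizer {w} ⊓ centralizer {h₁} ⊓ centralizer {h₂} <
      centralizer {w} ⊓ centralizer {h₁} :=
    lt_of_le_of_ne inf_le_left fun h =>
      hh₂ (comm (inf_eq_left.mp h (mem_inf.mpr ⟨comm hw1, self h₁⟩)))
  have s4 : center H < centralizer {w} ⊓ centralizer {h₁} ⊓ centralizer {h₂} :=
    lt_of_le_of_ne (le_inf (le_inf (hcent _) (hcent _)) (hcent _)) fun h =>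
      hwZ (h ▸ mem_inf.mpr ⟨mem_inf.mpr ⟨self w, hw1⟩, hw2⟩)
  have := hlt (k := 0) s4 (hlt (k := 1) s3 (hlt (k := 2) s2 (hlt (k := 3) s1
    (by rw [card_top, hcard]))))
  rw [hZ, pow_zero, Nat.dvd_one] at this
  exact hp.one_lt.ne' this

theorem le_upperCentralSeriesStep {G : Type*} [Group G] (N : Subgroup G) [N.Normal] {n : ℕ}
    (h : upperCentralSeries G n ≤ N) : upperCentralSeries G (n + 1) ≤ upperCentralSeriesStep N :=
  fun _ hg x => h (hg x)

/-- A normal subgroup containing `Z_j` properly contains `Z_{j+1}` if `|Z_{j+1} : Z_j| = p`. -/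
theorem upperCentralSeries_succ_le_of_card {G : Type*} [Group G] [Finite G]
    [Group.IsNilpotent G] {p : ℕ} (hp : p.Prime) {M : Subgroup G} [M.Normal] {j k : ℕ}
    (hj : Nat.card (upperCentralSeries G j) = p ^ k)
    (hj' : Nat.card (upperCentralSeries G (j + 1)) = p ^ (k + 1))
    (hle : upperCentralSeries G j ≤ M) (hne : ¬ M ≤ upperCentralSeries G j) :
    upperCentralSeries G (j + 1) ≤ M := by
  obtain ⟨g, hgM, hg, hg'⟩ := exists_mem_upperCentralSeries_succ_notMem hne
  have hlt : upperCentralSeries G j < M ⊓ upperCentralSeries G (j + 1) :=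
    lt_of_le_of_ne (le_inf hle (upperCentralSeries_mono G j.le_succ)) fun h =>
      hg' (h ▸ mem_inf.mpr ⟨hgM, hg⟩)
  obtain ⟨b, hb, hb'⟩ := (Nat.dvd_prime_pow hp).mp
    (hj' ▸ card_dvd_of_le (inf_le_right : M ⊓ upperCentralSeries G (j + 1) ≤ _))
  have hkb : k < b := by
    by_contra hle'
    refine hlt.ne (eq_of_le_of_card_ge hlt.le ?_)
    rw [hj, hb']
    exact Nat.pow_le_pow_right hp.pos (not_lt.mp hle')
  have : M ⊓ upperCentralSeries G (j + 1) = upperCentralSeries G (j + 1) := by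
    refine eq_of_le_of_card_ge inf_le_right ?_
    rw [hj', hb']
    exact Nat.pow_le_pow_right hp.pos hkb
  exact inf_eq_right.mp this

/-- If all the upper central factors below `Z_j` have order `p`, then the intersection of a normal
subgroup with `Z_j` is either `Z_j` or contained in `Z_{j-1}`. -/
theorem upperCentralSeries_le_or_inf_le {G : Type*} [Group G] [Finite G]
    [Group.IsNilpotent G] {p : ℕ} (hp : p.Prime) {e : ℕ → ℕ}
    (he : ∀ i, Nat.card (upperCentralSeries G i) = p ^ e i) (N : Subgroup G) [N.Normal] {j : ℕ}
    (hj : ∀ i, i ≤ j → e (i + 1) = e i + 1) :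
    upperCentralSeries G (j + 1) ≤ N ∨ N ⊓ upperCentralSeries G (j + 1) ≤ upperCentralSeries G j := by
  rw [or_iff_not_imp_right]
  intro h
  -- Climb from `Z_0`: the intersection does not lie in `Z_j`, hence in no lower `Z_i`, so it
  -- swallows each next term.
  have key : ∀ i, i ≤ j + 1 → upperCentralSeries G i ≤ N ⊓ upperCentralSeries G (j + 1) := by
    intro i
    induction i with
    | zero => intro _; simp
    | succ i ih =>
      intro hi
      exact upperCentralSeries_succ_le_of_card hp (he i) (by rw [he, hj i (by omega)])
        (ih (by omega)) fun h' => h (h'.trans (upperCentralSeries_mono G (by omega)))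
  exact (key (j + 1) le_rfl).trans inf_le_left

/-- In a nilpotent `p`-group in which the top upper central factor has order `p ^ 2` and at most one
other one has order greater than `p`, the preimage of the center of a quotient is a term of the upper
central series. -/
theorem exists_upperCentralSeriesStep_eq {G : Type*} [Group G] [Finite G]
    [Group.IsNilpotent G] {p : ℕ} (hp : p.Prime) {e : ℕ → ℕ}
    (he : ∀ i, Nat.card (upperCentralSeries G i) = p ^ e i)
    (hc : 1 ≤ Group.nilpotencyClass G)
    (htop : (upperCentralSeries G (Group.nilpotencyClass G - 1)).index = p ^ 2)
    (hmid : ∀ j, j + 1 < Group.nilpotencyClass G → e (j + 1) = e j + 1 ∨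
      ∀ i, i < j → e (i + 1) = e i + 1)
    (N : Subgroup G) [N.Normal] :
    ∃ i, 1 ≤ i ∧ i ≤ Group.nilpotencyClass G ∧
      upperCentralSeriesStep N = upperCentralSeries G i := by
  classical
  set c := Group.nilpotencyClass G with hcdef
  have hMn : (upperCentralSeriesStep N).Normal := by
    rw [upperCentralSeriesStep_eq_comap_center]; infer_instance
  have h1 : upperCentralSeries G 1 ≤ upperCentralSeriesStep N :=
    le_upperCentralSeriesStep N (by simp)
  let P : ℕ → Prop := fun j => upperCentralSeries G j ≤ upperCentralSeriesStep N
  set j := Nat.findGreatest P c with hj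
  have hPj : upperCentralSeries G j ≤ upperCentralSeriesStep N :=
    Nat.findGreatest_spec (P := P) hc h1
  have hj1 : 1 ≤ j := Nat.le_findGreatest (P := P) hc h1
  have hjc : j ≤ c := Nat.findGreatest_le c
  have hmax : j < c → ¬ upperCentralSeries G (j + 1) ≤ upperCentralSeriesStep N := fun h =>
    Nat.findGreatest_is_greatest (P := P) (Nat.lt_succ_self _) h
  refine ⟨j, hj1, hjc, le_antisymm ?_ hPj⟩
  by_contra hne
  have hjc' : j < c := by
    refine lt_of_le_of_ne hjc fun h => hne ?_
    rw [h, hcdef, upperCentralSeries_nilpotencyClass]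
    exact le_top
  -- At the top, properly containing a subgroup of index `p^2` leaves an index dividing `p`, which
  -- makes `G ⧸ N` abelian.
  by_cases hlast : j + 1 = c
  · have hjl : j = c - 1 := by omega
    refine hmax hjc' ((upperCentralSeriesStep_eq_top_of_index_dvd_prime N hp ?_).symm ▸ le_top)
    have hrel := relIndex_mul_index hPj
    rw [hjl, htop, ← hjl] at hrel
    obtain ⟨b, hb, hb'⟩ := (Nat.dvd_prime_pow hp).mp (Dvd.intro_left _ hrel)
    have : b ≠ 2 := by
      rintro rfl
      rw [hb'] at hrel
      refine hne (relIndex_eq_one.mp ?_)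
      exact Nat.eq_of_mul_eq_mul_right (pow_pos hp.pos 2) (by rw [hrel, one_mul])
    rw [hb']
    exact (pow_dvd_pow p (by omega : b ≤ 1)).trans (by rw [pow_one])
  · rcases hmid j (by omega) with h | h
    · exact hmax hjc' (upperCentralSeries_succ_le_of_card hp (he j) (by rw [he, h]) hPj hne)
    -- All factors below `Z_j` have order `p`. If `N` misses part of `Z_j`, then `⁅g, x⁆ ∈ N ⊓ Z_j ≤
    -- Z_{j-1}` for all `x`, which puts `g` in `Z_j`.
    · clear_value j
      obtain ⟨i, rfl⟩ : ∃ i, j = i + 1 := ⟨j - 1, by omega⟩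
      rcases upperCentralSeries_le_or_inf_le hp he N (j := i) fun k hk => h k (by omega) with h' | h'
      · exact hmax hjc' (le_upperCentralSeriesStep N h')
      · obtain ⟨g, hgM, hg, hg'⟩ := exists_mem_upperCentralSeries_succ_notMem hne
        exact hg' fun x => h' (mem_inf.mpr ⟨hgM x, hg x⟩)

/-- If `Z_{k+1}` has index `p ^ 3` and `|Z_{k+1} : Z_k| = p`, then `Z_{k+2}` is not the
whole group. -/
theorem upperCentralSeries_ne_top_of_index_eq_prime_pow {G : Type*} [Group G] {p k : ℕ}
    (hp : p.Prime) (h3 : (upperCentralSeries G (k + 1)).index = p ^ 3)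
    (h4 : (upperCentralSeries G k).index = p ^ 4) :
    upperCentralSeries G (k + 2) ≠ ⊤ := by
  intro htop
  have hcomap : upperCentralSeries G (k + 1) =
      (center (G ⧸ upperCentralSeries G k)).comap (QuotientGroup.mk' _) :=
    upperCentralSeriesStep_eq_comap_center (upperCentralSeries G k)
  have hidx : (center (G ⧸ upperCentralSeries G k)).index = p ^ 3 := by
    rw [← h3, hcomap, index_comap_of_surjective _ (QuotientGroup.mk'_surjective _)]
  have hcard : Nat.card (G ⧸ upperCentralSeries G k) = p ^ 4 := h4
  refine center_card_ne_prime_of_card_eq_prime_pow_four hp hcard ?_ ?_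
  · intro x y
    obtain ⟨x, rfl⟩ := QuotientGroup.mk'_surjective _ x
    obtain ⟨y, rfl⟩ := QuotientGroup.mk'_surjective _ y
    rw [← map_commutatorElement, ← mem_comap, ← hcomap]
    exact (htop ▸ mem_top x : x ∈ upperCentralSeries G (k + 2)) y
  · have := card_mul_index (center (G ⧸ upperCentralSeries G k))
    rw [hidx, hcard, pow_succ' p 3] at this
    exact Nat.eq_of_mul_eq_mul_right (pow_pos hp.pos 3) this

/-- Order counting. The final disjunction encodes that at most one factor below the top is larger
than `p`, in the form the case analysis consumes. -/
theorem exists_card_upperCentralSeries {p : ℕ} (hp : p.Prime) {G : Type*} [Group G]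
    [Finite G] [Group.IsNilpotent G] (hcoclass : HasCoclass p G 2)
    (hclass : 2 ≤ Group.nilpotencyClass G) :
    ∃ e : ℕ → ℕ, (∀ i, Nat.card (upperCentralSeries G i) = p ^ e i) ∧
      (∀ i, i ≤ Group.nilpotencyClass G → i ≤ e i) ∧
      (upperCentralSeries G (Group.nilpotencyClass G - 1)).index = p ^ 2 ∧
      ∀ j, j + 1 < Group.nilpotencyClass G → e (j + 1) = e j + 1 ∨
        ∀ i, i < j → e (i + 1) = e i + 1 := by
  obtain ⟨m, -, hcard, hm⟩ := hcoclass
  obtain ⟨k, hk⟩ : ∃ k, Group.nilpotencyClass G = k + 2 := ⟨_, (Nat.sub_add_cancel hclass).symm⟩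
  have hpow : ∀ i, ∃ a, Nat.card (upperCentralSeries G i) = p ^ a := fun i =>
    let ⟨a, _, ha⟩ := (Nat.dvd_prime_pow hp).mp (hcard ▸ card_subgroup_dvd_card _)
    ⟨a, ha⟩
  choose e he using hpow
  have hidx : ∀ {i r}, e i + r = m → (upperCentralSeries G i).index = p ^ r := by
    intro i r h
    have := card_mul_index (upperCentralSeries G i)
    rw [he, hcard, ← h, pow_add] at this
    exact Nat.eq_of_mul_eq_mul_left (pow_pos hp.pos _) this
  have hstep : ∀ i, i < k + 2 → e i < e (i + 1) := by
    intro i hi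
    by_contra hle
    have hlt := upperCentralSeries_lt_succ (G := G) (hk ▸ hi)
    refine hlt.ne (eq_of_le_of_card_ge hlt.le ?_)
    rw [he, he]
    exact Nat.pow_le_pow_right hp.pos (not_lt.mp hle)
  have hgap : ∀ i j, i ≤ j → j ≤ k + 2 → e i + (j - i) ≤ e j := by
    intro i j hij
    induction j, hij using Nat.le_induction with
    | base => simp
    | succ j hij ih =>
      intro hj
      have := hstep j hj
      have := ih (by omega)
      omega
  have hlast : e (k + 2) = m := by
    have := he (k + 2)
    rw [← hk, upperCentralSeries_nilpotencyClass, card_top, hcard, hk] at this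
    exact (Nat.pow_right_injective hp.two_le this).symm
  have hne1 : e (k + 1) + 1 ≠ m := fun h => by
    have := upperCentralSeriesStep_eq_top_of_index_dvd_prime (upperCentralSeries G k) hp
      ((hidx h).trans (pow_one p)).dvd
    have := (upperCentralSeries_eq_top_iff_nilpotencyClass_le (n := k + 1)).mp this
    omega
  have h01 := hgap 0 k (by omega) (by omega)
  have hs := hstep k (by omega)
  have hs' : e (k + 1) < e (k + 2) := hstep (k + 1) (by omega)
  -- The only alternative left by the count is `e (k + 1) = k + 1` and `e k = k`, the excluded
  -- quotient of order `p^4`.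
  have h2 : e (k + 1) + 2 = m := by
    by_contra h2
    refine upperCentralSeries_ne_top_of_index_eq_prime_pow hp (hidx (i := k + 1) (r := 3) ?_)
      (hidx (i := k) (r := 4) ?_) (hk ▸ upperCentralSeries_nilpotencyClass) <;> omega
  refine ⟨e, he, fun i hi => ?_, ?_, fun j hj => ?_⟩
  · have := hgap 0 i (by omega) (by omega)
    omega
  · rw [hk]
    exact hidx h2
  · by_contra! h
    obtain ⟨hj', i, hi, hi'⟩ := h
    -- Two jumps of at least 2 would give `e (k + 1) ≥ k + 3`, but `e (k + 1) = k + 2`.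
    have := hstep i (by omega)
    have := hstep j (by omega)
    have := hgap 0 i (by omega) (by omega)
    have := hgap (i + 1) j (by omega) (by omega)
    have := hgap (j + 1) (k + 1) (by omega) (by omega)
    omega

end Subgroup

/-! ### Eigenvalues of operators of finite order. -/

open Module

/-- An endomorphism of finite order of a finite-dimensional complex vector space has a basis of
eigenvectors, whose eigenvalues are roots of unity. -/
theorem Module.End.exists_basis_eigenvectors_of_pow_eq_one {V : Type*} [AddCommGroup V]
    [Module ℂ V] [FiniteDimensional ℂ V] {f : Module.End ℂ V} {n : ℕ} (hn : n ≠ 0)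
    (hf : f ^ n = 1) :
    ∃ (b : Basis (Fin (finrank ℂ V)) ℂ V) (μ : Fin (finrank ℂ V) → ℂ),
      (∀ i, f (b i) = μ i • b i) ∧ ∀ i, μ i ^ n = 1 := by
  classical
  have hss : f.IsSemisimple := Module.End.isSemisimple_of_squarefree_aeval_eq_zero
    (Polynomial.X_pow_sub_one_separable_iff.mpr (Nat.cast_ne_zero.mpr hn)).squarefree
    (by simp [hf])
  have hint : DirectSum.IsInternal f.eigenspace :=
    DirectSum.isInternal_submodule_of_iSupIndep_of_iSup_eq_top f.eigenspaces_iSupIndep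
      hss.iSup_eigenspace_eq_top
  let b' := hint.collectedBasis fun μ => Module.finBasis ℂ (f.eigenspace μ)
  have : Finite ((μ : ℂ) × Fin (finrank ℂ (f.eigenspace μ))) := Module.Finite.finite_basis b'
  have := Fintype.ofFinite ((μ : ℂ) × Fin (finrank ℂ (f.eigenspace μ)))
  let σ := Fintype.equivFinOfCardEq (finrank_eq_card_basis b').symm
  have hb : ∀ i, f (b'.reindex σ i) = (σ.symm i).1 • b'.reindex σ i := fun i => by
    rw [Basis.reindex_apply]
    exact Module.End.mem_eigenspace_iff.mp (hint.collectedBasis_mem _ _)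
  refine ⟨b'.reindex σ, fun i => (σ.symm i).1, hb, fun i => ?_⟩
  have hpow : ∀ k : ℕ, (f ^ k) (b'.reindex σ i) = (σ.symm i).1 ^ k • b'.reindex σ i := by
    intro k
    induction k with
    | zero => simp
    | succ k ih => rw [pow_succ, Module.End.mul_apply, hb, map_smul, ih, smul_smul, pow_succ']
  have h1 := hpow n
  rw [hf, Module.End.one_apply] at h1
  refine smul_left_injective ℂ ((b'.reindex σ).ne_zero i) ?_
  simp only [one_smul]
  exact h1.symm

theorem LinearMap.trace_eq_sum_of_apply_basis_eq_smul {R V ι : Type*} [CommRing R]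
    [AddCommGroup V] [Module R V] [Fintype ι] (b : Basis ι R V) {f : Module.End R V}
    {μ : ι → R} (h : ∀ i, f (b i) = μ i • b i) : LinearMap.trace R V f = ∑ i, μ i := by
  classical
  rw [LinearMap.trace_eq_matrix_trace R b, Matrix.trace]
  refine Finset.sum_congr rfl fun i _ => ?_
  rw [Matrix.diag_apply, LinearMap.toMatrix_apply, h]
  simp

/-- If `n` complex numbers of absolute value one have a sum of absolute value `n`, they coincide. -/
theorem Complex.eq_of_norm_sum_eq_card {ι : Type*} [Fintype ι] {μ : ι → ℂ}
    (h1 : ∀ i, ‖μ i‖ = 1) (hs : ‖∑ i, μ i‖ = Fintype.card ι) (i j : ι) : μ i = μ j := by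
  set s := ∑ i, μ i with hsdef
  have hs0 : s ≠ 0 := by
    rintro h
    rw [h, norm_zero] at hs
    have := Fintype.card_pos_iff.mpr ⟨i⟩
    exact this.ne (by exact_mod_cast hs)
  -- Each term is at most `‖s‖` and the terms add up to `‖s‖ ^ 2 = n ‖s‖`, so all are equalities.
  have key : ∀ k, (μ k * (starRingEnd ℂ) s).re = ‖s‖ := by
    have hle : ∀ k ∈ Finset.univ, (μ k * (starRingEnd ℂ) s).re ≤ ‖s‖ := fun k _ => by
      refine (Complex.re_le_norm _).trans ?_
      rw [norm_mul, h1, one_mul, RCLike.norm_conj]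
    have hsum : ∑ k, (μ k * (starRingEnd ℂ) s).re = ∑ _k : ι, ‖s‖ := by
      rw [← Complex.re_sum, ← Finset.sum_mul, ← hsdef, Complex.mul_conj, Complex.ofReal_re,
        Complex.normSq_eq_norm_sq, Finset.sum_const, Finset.card_univ, nsmul_eq_mul, ← hs, sq]
    exact fun k => (Finset.sum_eq_sum_iff_of_le hle).mp hsum k (Finset.mem_univ k)
  have key2 : ∀ k, μ k * (starRingEnd ℂ) s = ‖s‖ := fun k => by
    have hn : ‖μ k * (starRingEnd ℂ) s‖ = ‖s‖ := by rw [norm_mul, h1, one_mul, RCLike.norm_conj]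
    have : (μ k * (starRingEnd ℂ) s).re = ‖μ k * (starRingEnd ℂ) s‖ := by rw [key, hn]
    rw [← hn]
    exact (Complex.re_eq_norm.mp this |> Complex.eq_coe_norm_of_nonneg)
  exact mul_right_cancel₀ (by simpa using hs0) ((key2 i).trans (key2 j).symm)

/-! ### Character values as sums of roots of unity. -/

namespace Representation

section Character

variable {G V : Type*} [Group G] [Finite G] [AddCommGroup V] [Module ℂ V] [FiniteDimensional ℂ V]
  (ρ : Representation ℂ G V)

theorem exists_basis_eigenvectors (g : G) :
    ∃ (b : Basis (Fin (finrank ℂ V)) ℂ V) (μ : Fin (finrank ℂ V) → ℂ),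
      (∀ i, ρ g (b i) = μ i • b i) ∧ ∀ i, μ i ^ Nat.card G = 1 :=
  Module.End.exists_basis_eigenvectors_of_pow_eq_one Nat.card_pos.ne'
    (by rw [← map_pow, pow_card_eq_one', map_one] : ρ g ^ Nat.card G = 1)

theorem norm_eq_one_of_pow_card_eq_one {ι : Type*} {μ : ι → ℂ}
    (h : ∀ i, μ i ^ Nat.card G = 1) (i : ι) : ‖μ i‖ = 1 :=
  Complex.norm_eq_one_of_pow_eq_one (h i) Nat.card_pos.ne'

theorem char_inv_eq_conj (g : G) : ρ.character g⁻¹ = (starRingEnd ℂ) (ρ.character g) := by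
  obtain ⟨b, μ, hb, hpow⟩ := ρ.exists_basis_eigenvectors g
  have hμ := norm_eq_one_of_pow_card_eq_one hpow
  have h0 : ∀ i, μ i ≠ 0 := fun i h => by simpa [h] using hμ i
  have hb' : ∀ i, ρ g⁻¹ (b i) = (μ i)⁻¹ • b i := fun i => by
    rw [eq_inv_smul_iff₀ (h0 i), ← map_smul, ← hb, inv_self_apply]
  rw [character, character, LinearMap.trace_eq_sum_of_apply_basis_eq_smul b hb,
    LinearMap.trace_eq_sum_of_apply_basis_eq_smul b hb', map_sum]
  exact Finset.sum_congr rfl fun i _ => Complex.inv_eq_conj (hμ i)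

theorem exists_eq_algebraMap_of_norm_char_eq {g : G} (h : ‖ρ.character g‖ = finrank ℂ V) :
    ∃ c : ℂ, ρ g = algebraMap ℂ (Module.End ℂ V) c := by
  obtain ⟨b, μ, hb, hpow⟩ := ρ.exists_basis_eigenvectors g
  have hμ := norm_eq_one_of_pow_card_eq_one hpow
  rw [character, LinearMap.trace_eq_sum_of_apply_basis_eq_smul b hb] at h
  have heq := Complex.eq_of_norm_sum_eq_card hμ (by rw [h, Fintype.card_fin])
  rcases isEmpty_or_nonempty (Fin (finrank ℂ V)) with he | ⟨⟨i⟩⟩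
  · exact ⟨0, b.ext fun i => isEmptyElim i⟩
  · exact ⟨μ i, b.ext fun j => by rw [hb, heq j i, Module.algebraMap_end_apply]⟩

theorem norm_char_eq_of_eq_algebraMap {g : G} {c : ℂ}
    (h : ρ g = algebraMap ℂ (Module.End ℂ V) c) : ‖ρ.character g‖ = finrank ℂ V := by
  obtain ⟨b, μ, hb, hpow⟩ := ρ.exists_basis_eigenvectors g
  have hμ := norm_eq_one_of_pow_card_eq_one hpow
  have hc : ∀ i, μ i = c := fun i => by
    refine smul_left_injective ℂ (b.ne_zero i) ?_
    simp only [← hb, h, Module.algebraMap_end_apply]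
  rw [character, LinearMap.trace_eq_sum_of_apply_basis_eq_smul b hb]
  rcases isEmpty_or_nonempty (Fin (finrank ℂ V)) with he | ⟨⟨i⟩⟩
  · have : finrank ℂ V = 0 := by
      rw [← Fintype.card_fin (finrank ℂ V)]
      exact Fintype.card_eq_zero_iff.mpr he
    simp [this]
  · have hc1 : ‖c‖ = 1 := hc i ▸ hμ i
    simp [hc, hc1]

end Character

/-! ### Schur's lemma, inflation, and separation of elements by irreducibles. -/

section Irreducible

variable {k G V : Type*} [Field k] [Group G] [AddCommGroup V] [Module k V]

theorem IsIrreducible.exists_eq_algebraMap_of_commute [IsAlgClosed k] [FiniteDimensional k V]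
    {ρ : Representation k G V} [ρ.IsIrreducible] {f : Module.End k V}
    (hf : ∀ x, Commute f (ρ x)) : ∃ c : k, f = algebraMap k (Module.End k V) c := by
  obtain ⟨c, hc⟩ := (IsIrreducible.algebraMap_intertwiningMap_bijective_of_isAlgClosed (ρ := ρ)).2
    ⟨f, fun x => hf x⟩
  exact ⟨c, (congrArg IntertwiningMap.toLinearMap hc).symm⟩

theorem IsIrreducible.nontrivial {ρ : Representation k G V} [ρ.IsIrreducible] : Nontrivial V := by
  by_contra h
  rw [not_nontrivial_iff_subsingleton] at h
  obtain ⟨a, b, hab⟩ := exists_pair_ne (Subrepresentation ρ)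
  exact hab (Subrepresentation.toSubmodule_injective (Subsingleton.elim _ _))

theorem IsIrreducible.of_equiv {W : Type*} [AddCommGroup W] [Module k W]
    {ρ : Representation k G V} {σ : Representation k G W} (e : ρ.Equiv σ) [ρ.IsIrreducible] :
    σ.IsIrreducible := by
  rw [irreducible_iff_isSimpleModule_asModule]
  exact IsSimpleModule.congr (LinearEquiv.ofBijective
    (IntertwiningMap.equivLinearMapAsModule ρ σ e.toIntertwiningMap)
    e.toLinearEquiv.bijective).symm

/-- The inflation of an irreducible representation is irreducible. -/
theorem IsIrreducible.comp {H : Type*} [Group H] {ρ : Representation k H V} [ρ.IsIrreducible]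
    {f : G →* H} (hf : Function.Surjective f) :
    IsIrreducible (ρ.comp f : Representation k G V) := by
  let e : Subrepresentation (ρ.comp f : Representation k G V) ≃o Subrepresentation ρ :=
    { toFun := fun σ => ⟨σ.toSubmodule, fun h v hv => by
        obtain ⟨g, rfl⟩ := hf h
        exact σ.apply_mem_toSubmodule g hv⟩
      invFun := fun σ => ⟨σ.toSubmodule, fun g v hv => σ.apply_mem_toSubmodule (f g) hv⟩
      left_inv := fun _ => rfl
      right_inv := fun _ => rfl
      map_rel_iff' := Iff.rfl }
  exact (OrderIso.isSimpleOrder_iff e).mpr inferInstance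

end Irreducible

/-- Moves a representation to the coordinate space required by `irrChars`; one inclusion of kernels
is enough for separation. -/
theorem IsIrreducible.exists_conj_fin {k G V : Type*} [Field k] [Group G] [AddCommGroup V]
    [Module k V] [FiniteDimensional k V] (ρ : Representation k G V) [ρ.IsIrreducible] :
    ∃ σ : Representation k G (Fin (finrank k V) → k), σ.IsIrreducible ∧
      ∀ g, σ g = 1 → ρ g = 1 := by
  let e : V ≃ₗ[k] (Fin (finrank k V) → k) := (finBasis k V).equivFun
  let σ : Representation k G (Fin (finrank k V) → k) :=
    (e.conjRingEquiv : Module.End k V →* Module.End k (Fin (finrank k V) → k)).comp ρ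
  have hσ : ∀ g v, σ g v = e (ρ g (e.symm v)) := fun _ _ => rfl
  refine ⟨σ, IsIrreducible.of_equiv (ρ := ρ) (Equiv.mk e fun g => ?_), fun g hg => ?_⟩
  · ext v
    simp [hσ]
  · ext v
    have := hσ g (e v)
    rw [hg, e.symm_apply_apply] at this
    exact (e.injective this).symm

/-- Maschke and induction on dimension: if `g` acts trivially on two complementary summands, it acts
trivially on the whole space. -/
theorem exists_isIrreducible_apply_ne_one_of_apply_ne_one {G V : Type*} [Group G] [Finite G]
    [AddCommGroup V] [Module ℂ V] [FiniteDimensional ℂ V] (ρ : Representation ℂ G V) {g : G}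
    (hg : ρ g ≠ 1) :
    ∃ (d : ℕ) (σ : Representation ℂ G (Fin d → ℂ)), σ.IsIrreducible ∧ σ g ≠ 1 := by
  induction hn : finrank ℂ V using Nat.strong_induction_on generalizing V with
  | _ n ih =>
    subst hn
    by_cases hirr : ρ.IsIrreducible
    · obtain ⟨σ, hσ, h⟩ := IsIrreducible.exists_conj_fin ρ
      exact ⟨_, σ, hσ, fun h' => hg (h g h')⟩
    have hV : Nontrivial V := by
      by_contra h
      rw [not_nontrivial_iff_subsingleton] at h
      exact hg (Subsingleton.elim _ _)
    have hnt : Nontrivial (Subrepresentation ρ) :=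
      ⟨⊥, ⊤, fun h => bot_ne_top (congrArg Subrepresentation.toSubmodule h)⟩
    obtain ⟨U, hU0, hU1⟩ : ∃ U : Subrepresentation ρ, U ≠ ⊥ ∧ U ≠ ⊤ := by
      by_contra! h
      exact hirr ⟨fun U => or_iff_not_imp_left.mpr (h U)⟩
    obtain ⟨U', hUU'⟩ := exists_isCompl U
    have hU1' : U' ≠ ⊤ := fun h => hU0 (by simpa [h] using hUU'.inf_eq_bot)
    have hsub : ∀ W : Subrepresentation ρ, W ≠ ⊤ → W.toRepresentation g ≠ 1 →
        ∃ (d : ℕ) (σ : Representation ℂ G (Fin d → ℂ)), σ.IsIrreducible ∧ σ g ≠ 1 :=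
      fun W hW h => ih _ (Submodule.finrank_lt
        fun h' => hW (Subrepresentation.toSubmodule_injective h')) W.toRepresentation h rfl
    by_contra hno
    have h1 : U.toRepresentation g = 1 := by_contra fun h => hno (hsub U hU1 h)
    have h2 : U'.toRepresentation g = 1 := by_contra fun h => hno (hsub U' hU1' h)
    refine hg (LinearMap.ext fun v => ?_)
    have hv : v ∈ U.toSubmodule ⊔ U'.toSubmodule := by
      rw [← Subrepresentation.toSubmodule_sup, hUU'.sup_eq_top]
      exact Submodule.mem_top
    obtain ⟨u, hu, u', hu', rfl⟩ := Submodule.mem_sup.mp hv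
    have e1 : ρ g u = u := congrArg Subtype.val (LinearMap.congr_fun h1 ⟨u, hu⟩)
    have e2 : ρ g u' = u' := congrArg Subtype.val (LinearMap.congr_fun h2 ⟨u', hu'⟩)
    rw [map_add, e1, e2, Module.End.one_apply]

/-- The irreducible complex representations of a finite group separate its elements. -/
theorem exists_isIrreducible_apply_ne_one {G : Type*} [Group G] [Finite G] {g : G} (hg : g ≠ 1) :
    ∃ (d : ℕ) (ρ : Representation ℂ G (Fin d → ℂ)), ρ.IsIrreducible ∧ ρ g ≠ 1 := by
  classical
  -- The regular representation is faithful: `g` moves the basis vector at 1 to the one at `g`.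
  refine exists_isIrreducible_apply_ne_one_of_apply_ne_one
    (Representation.ofMulAction ℂ G G) (g := g) fun h => hg ?_
  have h1 := congrArg (fun x : MonoidAlgebra ℂ G => x.coeff g)
    (LinearMap.congr_fun h (MonoidAlgebra.single 1 1))
  by_contra h2
  simp [MonoidAlgebra.coeff_single, Ne.symm h2] at h1

end Representation

/-! ### Degrees: orthogonality and divisibility. -/

namespace Representation

variable {G V : Type*} [Group G] [Finite G] [AddCommGroup V] [Module ℂ V] [FiniteDimensional ℂ V]
  (ρ : Representation ℂ G V)

theorem IsIrreducible.sum_char_mul_char_inv [Fintype G] [ρ.IsIrreducible] :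
    ∑ g, ρ.character g * ρ.character g⁻¹ = Nat.card G := by
  classical
  have hG : (Nat.card G : ℂ) ≠ 0 := Nat.cast_ne_zero.mpr Nat.card_pos.ne'
  let _ : Invertible (Nat.card G : ℂ) := invertibleOfNonzero hG
  have h := char_orthonormal ρ ρ
  rw [if_pos ⟨Equiv.refl ρ⟩] at h
  field_simp at h
  exact h

theorem IsIrreducible.sum_norm_char_sq [Fintype G] [ρ.IsIrreducible] :
    ∑ g, ‖ρ.character g‖ ^ 2 = (Nat.card G : ℝ) := by
  have h := IsIrreducible.sum_char_mul_char_inv ρ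
  simp only [char_inv_eq_conj, Complex.mul_conj, Complex.normSq_eq_norm_sq] at h
  exact_mod_cast h

/-- In `∑ ‖χ g‖ ^ 2 = |G|`, each `g ∈ H` contributes the full `χ(1) ^ 2`. -/
theorem IsIrreducible.finrank_sq_mul_card_le [ρ.IsIrreducible] (H : Subgroup G)
    (hH : ∀ g ∈ H, ‖ρ.character g‖ = finrank ℂ V) :
    finrank ℂ V ^ 2 * Nat.card H ≤ Nat.card G := by
  classical
  have := Fintype.ofFinite G
  have h := IsIrreducible.sum_norm_char_sq ρ
  have h1 : ∑ g ∈ Finset.univ.filter (· ∈ H), ‖ρ.character g‖ ^ 2 =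
      (Nat.card H : ℝ) * (finrank ℂ V : ℝ) ^ 2 := by
    rw [Finset.sum_congr rfl fun g hg => by rw [hH g (Finset.mem_filter.mp hg).2],
      Finset.sum_const, nsmul_eq_mul, ← Fintype.card_subtype, Nat.card_eq_fintype_card]
  have h2 : ∑ g ∈ Finset.univ.filter (· ∈ H), ‖ρ.character g‖ ^ 2 ≤
      ∑ g, ‖ρ.character g‖ ^ 2 :=
    Finset.sum_le_univ_sum_of_nonneg fun _ => sq_nonneg _
  rw [h1, h, mul_comm] at h2
  exact_mod_cast h2

theorem isIntegral_char (g : G) : IsIntegral ℤ (ρ.character g) := by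
  obtain ⟨b, μ, hb, hpow⟩ := ρ.exists_basis_eigenvectors g
  rw [character, LinearMap.trace_eq_sum_of_apply_basis_eq_smul b hb]
  exact IsIntegral.sum _ fun i _ => IsIntegral.of_pow Nat.card_pos (hpow i ▸ isIntegral_one)

/-- The degree of an irreducible complex representation divides the order of the group. -/
theorem IsIrreducible.finrank_dvd_card [ρ.IsIrreducible] : finrank ℂ V ∣ Nat.card G := by
  classical
  have := Fintype.ofFinite G
  -- The element `∑ χ(g⁻¹) g` of `A[G]` acts as a scalar `s` by Schur, integral because `A[G]` is
  -- finite over `A`. Its trace gives `s * χ(1) = |G|`, so the rational number `|G| / χ(1)` is an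
  -- integer.
  let A := integralClosure ℤ ℂ
  let a : G → A := fun g => ⟨ρ.character g⁻¹, ρ.isIntegral_char g⁻¹⟩
  let φ : MonoidAlgebra A G →ₐ[A] Module.End ℂ V := MonoidAlgebra.lift A (Module.End ℂ V) G ρ
  let x : MonoidAlgebra A G := ∑ g, MonoidAlgebra.single g (a g)
  have hφx : φ x = ∑ g, ρ.character g⁻¹ • ρ g := by
    rw [map_sum]
    refine Finset.sum_congr rfl fun g _ => ?_
    rw [MonoidAlgebra.lift_single]
    rfl
  obtain ⟨s, hs⟩ : ∃ s : ℂ, φ x = algebraMap ℂ (Module.End ℂ V) s := by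
    refine IsIrreducible.exists_eq_algebraMap_of_commute (ρ := ρ) fun h => ?_
    rw [hφx, commute_iff_eq, Finset.sum_mul, Finset.mul_sum]
    refine Fintype.sum_equiv (MulAut.conj h⁻¹).toEquiv _ _ fun g => ?_
    have h1 : ((MulAut.conj h⁻¹).toEquiv g)⁻¹ = h⁻¹ * g⁻¹ * h⁻¹⁻¹ := by
      simp [mul_assoc]
    rw [h1, char_conj, smul_mul_assoc, mul_smul_comm, ← map_mul, ← map_mul]
    simp [mul_assoc]
  have hint : IsIntegral ℤ s := by
    have h1 : IsIntegral A (φ x) := (IsIntegral.of_finite A x).map φ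
    have := (IsIrreducible.nontrivial (ρ := ρ))
    rw [hs, isIntegral_algebraMap_iff (FaithfulSMul.algebraMap_injective ℂ (Module.End ℂ V))] at h1
    exact isIntegral_trans s h1
  have htr : s * finrank ℂ V = Nat.card G := by
    have h := congrArg (LinearMap.trace ℂ V) hs
    rw [hφx, map_sum, Algebra.algebraMap_eq_smul_one, map_smul, LinearMap.trace_one,
      smul_eq_mul] at h
    rw [← h, ← IsIrreducible.sum_char_mul_char_inv ρ]
    refine Finset.sum_congr rfl fun g _ => ?_
    rw [map_smul, smul_eq_mul, mul_comm]
    rfl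
  have hd : (finrank ℂ V : ℚ) ≠ 0 := by
    have := (IsIrreducible.nontrivial (ρ := ρ))
    exact Nat.cast_ne_zero.mpr finrank_pos.ne'
  have hsq : s = algebraMap ℚ ℂ ((Nat.card G : ℚ) / finrank ℂ V) := by
    rw [eq_comm, map_div₀, map_natCast, map_natCast, ← htr,
      mul_div_cancel_right₀ _ (by exact_mod_cast hd)]
  rw [hsq, isIntegral_algebraMap_iff (algebraMap ℚ ℂ).injective] at hint
  obtain ⟨z, hz⟩ := IsIntegrallyClosed.isIntegral_iff.mp hint
  rw [eq_div_iff hd] at hz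
  refine Int.natCast_dvd_natCast.mp (Dvd.intro_left z ?_)
  rw [eq_intCast] at hz
  exact_mod_cast hz

end Representation

theorem Representation.exists_isIrreducible_le_ker {G : Type*} [Group G] [Finite G]
    (N : Subgroup G) [N.Normal] {h : G} (hN : h ∉ N) :
    ∃ (d : ℕ) (ρ : Representation ℂ G (Fin d → ℂ)),
      ρ.IsIrreducible ∧ N ≤ MonoidHom.ker ρ ∧ h ∉ MonoidHom.ker ρ := by
  obtain ⟨d, ρ, hρ, hh⟩ := Representation.exists_isIrreducible_apply_ne_one
    (g := (QuotientGroup.mk' N h)) fun h' => hN ((QuotientGroup.eq_one_iff h).mp h')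
  refine ⟨d, ρ.comp (QuotientGroup.mk' N),
    Representation.IsIrreducible.comp (QuotientGroup.mk'_surjective N), fun n hn => ?_, hh⟩
  rw [MonoidHom.mem_ker, MonoidHom.comp_apply, QuotientGroup.mk'_apply,
    (QuotientGroup.eq_one_iff n).mpr hn, map_one]

/-! ### Centers of irreducible characters. -/

namespace Subgroup

open scoped commutatorElement

section CharCenter

variable {G : Type*} [Group G] {d : ℕ} (ρ : Representation ℂ G (Fin d → ℂ))

theorem charDegree_character : charDegree ρ.character = d := by
  rw [charDegree, Representation.char_one, finrank_fin_fun, Complex.natCast_re]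

/-- The center of an irreducible character is the preimage of the center of the quotient by its
kernel. -/
theorem charCenter_character [Finite G] [ρ.IsIrreducible] :
    charCenter ρ.character = (upperCentralSeriesStep (MonoidHom.ker ρ) : Set G) := by
  ext g
  have hd : (d : ℝ) = finrank ℂ (Fin d → ℂ) := by rw [finrank_fin_fun]
  have hcomm : ∀ x, ⁅g, x⁆ ∈ MonoidHom.ker ρ ↔ Commute (ρ g) (ρ x) := fun x => by
    rw [MonoidHom.mem_ker, commute_iff_eq, ← map_mul, ← map_mul, commutatorElement_def]
    refine ⟨fun h => ?_, fun h => ?_⟩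
    · have h' : g * x = g * x * g⁻¹ * x⁻¹ * (x * g) := by group
      rw [h', map_mul, h, one_mul]
    · rw [map_mul, map_mul, h, ← map_mul, ← map_mul]
      simp
  rw [charCenter, Set.mem_ofPred_eq, charDegree_character, hd, SetLike.mem_coe,
    mem_upperCentralSeriesStep]
  simp only [hcomm]
  refine ⟨fun h x => ?_, fun h => ?_⟩
  · obtain ⟨c, hc⟩ := ρ.exists_eq_algebraMap_of_norm_char_eq h
    rw [hc]
    exact Algebra.commute_algebraMap_left c _
  · obtain ⟨c, hc⟩ := Representation.IsIrreducible.exists_eq_algebraMap_of_commute h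
    exact ρ.norm_char_eq_of_eq_algebraMap hc

theorem degree_sq_mul_card_le_of_charCenter_eq [Finite G] [ρ.IsIrreducible] {H : Subgroup G}
    (hH : charCenter ρ.character = (H : Set G)) : d ^ 2 * Nat.card H ≤ Nat.card G := by
  have := Representation.IsIrreducible.finrank_sq_mul_card_le ρ H fun g hg => by
    have h : g ∈ charCenter ρ.character := hH ▸ hg
    rw [finrank_fin_fun, ← charDegree_character ρ]
    exact h
  rwa [finrank_fin_fun] at this

end CharCenter

/-- If the center of every irreducible character is a term of the upper central series from `Z_1`
on, then every such term is the center of an irreducible character. -/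
theorem exists_charCenter_eq_upperCentralSeries {G : Type*} [Group G] [Finite G]
    [Group.IsNilpotent G]
    (h : ∀ χ ∈ irrChars G, ∃ i, 1 ≤ i ∧ i ≤ Group.nilpotencyClass G ∧
      charCenter χ = (upperCentralSeries G i : Set G))
    {i : ℕ} (hi : 1 ≤ i) (hic : i ≤ Group.nilpotencyClass G) :
    ∃ χ ∈ irrChars G, charCenter χ = (upperCentralSeries G i : Set G) := by
  obtain ⟨k, rfl⟩ : ∃ k, i = k + 1 := ⟨i - 1, by omega⟩
  -- A character trivial on `Z_k` but not at `x = ⁅g, y⁆`, with `g ∈ Z_{k+2}`, has a center that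
  -- contains `Z_{k+1}` and misses `g`. When `k + 1 = c`, any `x` outside `Z_k` serves.
  obtain ⟨x, hx, hx'⟩ : ∃ x : G, x ∉ upperCentralSeries G k ∧
      (k + 1 < Group.nilpotencyClass G → ∃ g ∈ upperCentralSeries G (k + 2), ∃ y, ⁅g, y⁆ = x) := by
    by_cases hk : k + 1 < Group.nilpotencyClass G
    · obtain ⟨g, hg, hg'⟩ := SetLike.exists_of_lt (upperCentralSeries_lt_succ hk)
      rw [mem_upperCentralSeries_succ_iff] at hg'
      push Not at hg'
      obtain ⟨y, hy⟩ := hg'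
      exact ⟨_, hy, fun _ => ⟨g, hg, y, rfl⟩⟩
    · obtain ⟨g, -, hg⟩ := SetLike.exists_of_lt (upperCentralSeries_lt_succ (G := G) hic)
      exact ⟨g, hg, fun h => absurd h hk⟩
  obtain ⟨d, ρ, hρ, hker, hxker⟩ := Representation.exists_isIrreducible_le_ker _ hx
  refine ⟨ρ.character, ⟨d, ρ, hρ, rfl⟩, ?_⟩
  obtain ⟨j, hj1, hjc, hj⟩ := h _ ⟨d, ρ, hρ, rfl⟩
  have hstep : upperCentralSeriesStep (MonoidHom.ker ρ) = upperCentralSeries G j :=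
    SetLike.coe_injective ((charCenter_character ρ).symm.trans hj)
  have hle : upperCentralSeries G (k + 1) ≤ upperCentralSeries G j :=
    hstep ▸ le_upperCentralSeriesStep _ hker
  rw [hj]
  refine congrArg _ (le_antisymm ?_ hle)
  by_cases hk : k + 1 < Group.nilpotencyClass G
  · refine upperCentralSeries_mono G ?_
    by_contra hlt
    obtain ⟨g, hg, y, rfl⟩ := hx' hk
    have hg' : g ∈ upperCentralSeriesStep (MonoidHom.ker ρ) :=
      hstep ▸ upperCentralSeries_mono G (by omega : k + 2 ≤ j) hg
    exact hxker (hg' y)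
  · rw [(by omega : k + 1 = Group.nilpotencyClass G), upperCentralSeries_nilpotencyClass]
    exact le_top

theorem exists_degree_eq_prime_pow {p m : ℕ} (hp : p.Prime) {G : Type*} [Group G] [Finite G]
    (hcard : Nat.card G = p ^ m) {χ : G → ℂ} (hχ : χ ∈ irrChars G) {H : Subgroup G}
    (hH : charCenter χ = (H : Set G)) :
    ∃ a, charDegree χ = (p ^ a : ℕ) ∧ (p ^ a) ^ 2 * Nat.card H ≤ p ^ m := by
  obtain ⟨d, ρ, hρ, rfl⟩ := hχ
  have hd := Representation.IsIrreducible.finrank_dvd_card ρ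
  rw [finrank_fin_fun, hcard] at hd
  obtain ⟨a, -, rfl⟩ := (Nat.dvd_prime_pow hp).mp hd
  exact ⟨a, charDegree_character ρ, hcard ▸ degree_sq_mul_card_le_of_charCenter_eq ρ hH⟩

end Subgroup

/-! ### The theorem on coclass two. -/

theorem mainTheorem11 (p : ℕ) (hp : p.Prime) (G : Type*) [Group G] [Finite G]
    (hG : IsPGroup p G) (hcoclass : HasCoclass p G 2)
    (hclass : 3 ≤ Group.nilpotencyClass G) :
    (IsNested G ∧
      IsChainOfCenters (Group.nilpotencyClass G - 1)
        (fun i => Subgroup.upperCentralSeries G (Group.nilpotencyClass G - i))) ∧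
    (4 ≤ Group.nilpotencyClass G → ¬ IsNestedByDegrees G) := by
  have := Fact.mk hp
  have : Group.IsNilpotent G := hG.isNilpotent
  obtain ⟨e, he, hei, htop, hmid⟩ := Subgroup.exists_card_upperCentralSeries hp hcoclass (by omega)
  have hcenter : ∀ χ ∈ irrChars G, ∃ i, 1 ≤ i ∧ i ≤ Group.nilpotencyClass G ∧
      charCenter χ = (Subgroup.upperCentralSeries G i : Set G) := by
    rintro _ ⟨d, ρ, hρ, rfl⟩
    obtain ⟨i, hi, hic, h⟩ :=
      Subgroup.exists_upperCentralSeriesStep_eq hp he (by omega) htop hmid (MonoidHom.ker ρ)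
    exact ⟨i, hi, hic, by rw [Subgroup.charCenter_character, h]⟩
  have hexists := @Subgroup.exists_charCenter_eq_upperCentralSeries G _ _ _ hcenter
  refine ⟨⟨fun χ hχ ψ hψ => ?_, ?_, fun i hi => ?_, fun i _ => inferInstance, fun χ hχ => ?_,
    fun i hi => hexists (by omega) (by omega)⟩, fun hc4 hdeg => ?_⟩
  · obtain ⟨i, -, -, hi⟩ := hcenter χ hχ
    obtain ⟨j, -, -, hj⟩ := hcenter ψ hψ
    rw [hi, hj]
    exact (le_total i j).imp (fun h => Subgroup.upperCentralSeries_mono G h)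
      fun h => Subgroup.upperCentralSeries_mono G h
  · simp
  · have := Subgroup.upperCentralSeries_lt_succ (G := G) (i := Group.nilpotencyClass G - (i + 1)) (by omega)
    rwa [(by omega : Group.nilpotencyClass G - (i + 1) + 1 = Group.nilpotencyClass G - i)] at this
  · obtain ⟨i, hi, hic, h⟩ := hcenter χ hχ
    refine ⟨Group.nilpotencyClass G - i, by omega, ?_⟩
    simp only [h, (by omega : Group.nilpotencyClass G - (Group.nilpotencyClass G - i) = i)]
  · obtain ⟨m, -, hcard, hm⟩ := hcoclass
    have hlt : ∀ i, i < Group.nilpotencyClass G → ∀ χ ∈ irrChars G, ∀ ψ ∈ irrChars G,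
        charCenter χ = (Subgroup.upperCentralSeries G i : Set G) →
        charCenter ψ = (Subgroup.upperCentralSeries G (i + 1) : Set G) →
        charDegree ψ < charDegree χ := by
      intro i hi χ hχ ψ hψ h1 h2
      by_contra hle
      have := hdeg ψ hψ χ hχ (not_lt.mp hle)
      rw [h1, h2] at this
      exact (Subgroup.upperCentralSeries_lt_succ hi).not_ge this
    -- `c ≥ 4` makes `Z_{c-3}` a term from `Z_1` on, so four consecutive terms are centers of
    -- characters.
    obtain ⟨k, hk⟩ : ∃ k, Group.nilpotencyClass G = k + 4 := ⟨_, (Nat.sub_add_cancel hc4).symm⟩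
    obtain ⟨χ₁, h₁, hZ₁⟩ := hexists (i := k + 1) (by omega) (by omega)
    obtain ⟨χ₂, h₂, hZ₂⟩ := hexists (i := k + 2) (by omega) (by omega)
    obtain ⟨χ₃, h₃, hZ₃⟩ := hexists (i := k + 3) (by omega) (by omega)
    obtain ⟨χ₄, h₄, hZ₄⟩ := hexists (i := k + 4) (by omega) (by omega)
    obtain ⟨a₁, ha₁, hb₁⟩ := Subgroup.exists_degree_eq_prime_pow hp hcard h₁ hZ₁
    obtain ⟨a₂, ha₂, -⟩ := Subgroup.exists_degree_eq_prime_pow hp hcard h₂ hZ₂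
    obtain ⟨a₃, ha₃, -⟩ := Subgroup.exists_degree_eq_prime_pow hp hcard h₃ hZ₃
    obtain ⟨a₄, ha₄, -⟩ := Subgroup.exists_degree_eq_prime_pow hp hcard h₄ hZ₄
    have l₁ := hlt (k + 1) (by omega) _ h₁ _ h₂ hZ₁ hZ₂
    have l₂ := hlt (k + 2) (by omega) _ h₂ _ h₃ hZ₂ hZ₃
    have l₃ := hlt (k + 3) (by omega) _ h₃ _ h₄ hZ₃ hZ₄
    rw [ha₁, ha₂, Nat.cast_lt, Nat.pow_lt_pow_iff_right hp.one_lt] at l₁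
    rw [ha₂, ha₃, Nat.cast_lt, Nat.pow_lt_pow_iff_right hp.one_lt] at l₂
    rw [ha₃, ha₄, Nat.cast_lt, Nat.pow_lt_pow_iff_right hp.one_lt] at l₃
    -- Three strict increases force `a₁ ≥ 3`, whereas `2 * a₁ + e (k + 1) ≤ m = k + 6` and `e (k +
    -- 1) ≥ k + 1` force `a₁ ≤ 2`.
    rw [he, ← pow_mul, ← pow_add, Nat.pow_le_pow_iff_right hp.one_lt] at hb₁
    have := hei (k + 1) (by omega)
    omega
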